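/- \textbf{Programs.} A ground program with aggregates $P$ has a finite set $F_P$ of constants (integers or other names), a finite set of predicate symbols with arities, and finitely many ground rules $$A \leftarrow C_1,\dots,C_m,\,A_1,\dots,A_n,\,\mathit{not}\,B_1,\dots,\mathit{not}\,B_k ,$$ where $A,A_i,B_i$ are ground atoms over these symbols and each $C_i$ is a ground aggregate atom $\mathit{aggr}(s)\ \mathtt{op}\ v$. Here $\mathit{aggr}$ is an aggregate function symbol, $\mathtt{op}\in\{=,\neq,<,>,\le,\ge\}$, $v\in\mathbb Z\cap F_P$, and $s$ is an intensional set $\{X\mid p(\dots)\}$, the arguments of $p$ being constants of $F_P$ or $X$, or an intensional multiset $\{\!\{X\mid\exists \bar Z.\,p(\dots)\}\!\}$, the arguments being constants of $F_P$, $X$, or the variables $\bar Z$; all the named variables occur in $p(\dots)$. An interpretation is a set $I$ of ground atoms over the symbols of $P$. The value of $s$ in $I$ is the set of all $a \in F_P$ such that the instance $X/a$ of $p(\dots)$ is in $I$, respectively the multiset in which $a$ occurs once for every substitution of $\bar Z$ by constants of $F_P$ which together with $X/a$ gives an atom in $I$. Each aggregate function symbol has a fixed interpretation as a map from finite sets and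 finite multisets of constants to $\mathbb Z$; this determines when $I\models\ell$ for an aggregate atom $\ell$. \textbf{Fixpoint answer sets.} Let $\mathcal H(\ell)$ be the set of atoms formed from the predicate of $\ell$ and constants of $F_P$. A pair $\langle S_1,S_2\rangle$ of disjoint subsets of $\mathcal H(\ell)$ is a solution of $\ell$ if $I\models\ell$ for every interpretation $I$ with $S_1\subseteq I$ and $S_2\cap I=\emptyset$. For interpretations $M$, $I$ let $K^P_M(I)$ be the set of heads of those rules of $P$ (in the notation above) for which no $B_i$ is in $M$, all $A_i$ are in $I$, and $\langle I\cap M\cap\mathcal H(C_i),\ \mathcal H(C_i)\setminus M\rangle$ is a solution of $C_i$ for all $i$. An interpretation $M$ is a fixpoint answer set of $P$ if $M$ is the least fixpoint of the (monotone) operator $K_M^P$. \textbf{Complexity.} For a language $O$, $\mathbf{P}^O$ and $\mathbf{NP}^O$ are the classes of languages decidable in polynomial time, respectively having polynomially bounded certificates that are verifiable in polynomial time, by machines with oracle $O$. For a class $C$ of languages, $\mathbf{NP}^C=\bigcup_{O\in C}\mathbf{NP}^O$, and $\textbf{co-NP}^C$ consists of the complements of the languages in $\mathbf{NP}^C$.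 Instances are finite objects in a standard encoding (numbers in binary, finite sets as lists), and their size is the length of the encoding. A set $\mathcal Q$ of ground programs is called $C$-decidable if there is a language $A\in C$ such that for all $P\in\mathcal Q$, all aggregate atoms $\ell$ occurring in $P$ and all interpretations $M$ of $P$, the encoding of $(\ell,M)$ (for every listing of $M$) belongs to $A$ if and only if $M\models\ell$. \textbf{Statement.} Let $C$ be any class of languages, fix any interpretation of the aggregate function symbols, and let $\mathcal Q$ be a $C$-decidable set of ground programs with aggregates. Then the problem ``given $P\in\mathcal Q$, determine whether $P$ has a fixpoint answer set'' is in $\mathbf{NP}^{\textbf{co-NP}^C}$: there is a language $L\in\mathbf{NP}^{\textbf{co-NP}^C}$ such that for every $P\in\mathcal Q$, the encoding of $P$ is in $L$ if and only if $P$ has a fixpoint answer set. -/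

import Mathlib

/-! ### Machine model: while-programs on binary trees, with an oracle and a step count

Instances of decision problems are binary trees (S-expressions over one atom `nil`).
A machine has registers holding binary trees. Every instruction that creates or queries a
value is charged the size of that value, so every value that occurs has size at most
input size + running time; hence polynomial time here is ordinary
(oracle) Turing-machine polynomial time. -/

/-- Binary trees. -/
inductive Sexp : Type
  | nil : Sexp
  | cons : Sexp → Sexp → Sexp

/-- Number of nodes of a tree (leaves included): the length of an instance. -/
def Sexp.size : Sexp → ℕ
  | .nil => 1
  | .cons a b => 1 + a.size + b.size

/-- Left component, `nil` for `nil`. -/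
def Sexp.hd : Sexp → Sexp
  | .nil => .nil
  | .cons a _ => a

/-- Right component, `nil` for `nil`. -/
def Sexp.tl : Sexp → Sexp
  | .nil => .nil
  | .cons _ b => b

/-- `false` is coded by `nil`, `true` by `(nil . nil)`. -/
def Sexp.ofBool : Bool → Sexp
  | false => .nil
  | true => .cons .nil .nil

/-- A language is a set of instances. -/
abbrev Lang := Set Sexp

/-- Oracle while-programs; registers are numbered by natural numbers. -/
inductive Cmd : Type
  | setNil (x : ℕ) : Cmd
  | copy (x y : ℕ) : Cmd
  | cons (x y z : ℕ) : Cmd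
  | hd (x y : ℕ) : Cmd
  | tl (x y : ℕ) : Cmd
  | query (x y : ℕ) : Cmd
  | seq (c d : Cmd) : Cmd
  | ite (x : ℕ) (c d : Cmd) : Cmd
  | loop (x : ℕ) (c : Cmd) : Cmd

/-- Contents of the registers. -/
abbrev Store := ℕ → Sexp

open Classical in
/-- `Exec O c s t s'`: with oracle `O`, the program `c` started in `s` halts in `s'`
after `t` steps. The test of `ite` and `loop` is "register `x` is not `nil`";
`query x y` stores in `x` the truth value of "the content of `y` belongs to `O`". -/
inductive Exec (O : Lang) : Cmd → Store → ℕ → Store → Prop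
  | setNil (x : ℕ) (s : Store) : Exec O (.setNil x) s 1 (Function.update s x .nil)
  | copy (x y : ℕ) (s : Store) :
      Exec O (.copy x y) s (1 + (s y).size) (Function.update s x (s y))
  | cons (x y z : ℕ) (s : Store) :
      Exec O (.cons x y z) s (1 + (Sexp.cons (s y) (s z)).size)
        (Function.update s x (Sexp.cons (s y) (s z)))
  | hd (x y : ℕ) (s : Store) :
      Exec O (.hd x y) s (1 + (s y).hd.size) (Function.update s x (s y).hd)
  | tl (x y : ℕ) (s : Store) :
      Exec O (.tl x y) s (1 + (s y).tl.size) (Function.update s x (s y).tl)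
  | query (x y : ℕ) (s : Store) :
      Exec O (.query x y) s (1 + (s y).size)
        (Function.update s x (Sexp.ofBool (decide (s y ∈ O))))
  | seq {c d : Cmd} {s s' s'' : Store} {t t' : ℕ} :
      Exec O c s t s' → Exec O d s' t' s'' → Exec O (.seq c d) s (t + t') s''
  | iteTrue {x : ℕ} {c d : Cmd} {s s' : Store} {t : ℕ} :
      s x ≠ .nil → Exec O c s t s' → Exec O (.ite x c d) s (1 + t) s'
  | iteFalse {x : ℕ} {c d : Cmd} {s s' : Store} {t : ℕ} :
      s x = .nil → Exec O d s t s' → Exec O (.ite x c d) s (1 + t) s'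
  | loopStop {x : ℕ} {c : Cmd} {s : Store} :
      s x = .nil → Exec O (.loop x c) s 1 s
  | loopStep {x : ℕ} {c : Cmd} {s s' s'' : Store} {t t' : ℕ} :
      s x ≠ .nil → Exec O c s t s' → Exec O (.loop x c) s' t' s'' →
      Exec O (.loop x c) s (1 + t + t') s''

/-- The input is placed in register `0`, all other registers hold `nil`. -/
def initStore (x : Sexp) : Store := Function.update (fun _ => Sexp.nil) 0 x

/-- The class `P^O`: some program with oracle `O` halts on every input within a number of
steps polynomial in the input size, and accepts (register `0` is not `nil`) exactly the
members of the language. -/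
def PWith (O : Lang) : Set Lang :=
  {R | ∃ (c : Cmd) (p : Polynomial ℕ), ∀ x : Sexp, ∃ (t : ℕ) (s : Store),
    Exec O c (initStore x) t s ∧ t ≤ p.eval x.size ∧ (s 0 ≠ Sexp.nil ↔ x ∈ R)}

/-- The class `NP^O`: polynomially bounded certificates, checked in `P^O`. -/
def NPWith (O : Lang) : Set Lang :=
  {L | ∃ R ∈ PWith O, ∃ q : Polynomial ℕ, ∀ x : Sexp,
    x ∈ L ↔ ∃ w : Sexp, w.size ≤ q.eval x.size ∧ Sexp.cons x w ∈ R}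

/-- `NP^𝒞` for a class `𝒞` of languages: the union of `NP^O` over `O ∈ 𝒞`. -/
def NPRel (𝒞 : Set Lang) : Set Lang := {L | ∃ O ∈ 𝒞, L ∈ NPWith O}

/-- `co-NP^𝒞`: the complements of the languages in `NP^𝒞`. -/
def coNPRel (𝒞 : Set Lang) : Set Lang := {L | Lᶜ ∈ NPRel 𝒞}

/-! ### Syntax of ground programs with aggregates -/

/-- Constants: the integers, and further names. -/
inductive Const : Type
  | int (z : ℤ) : Const
  | sym (n : ℕ) : Const
  deriving DecidableEq

/-- A ground atom `p(t₁,…,tₙ)`; its predicate symbol is the pair (name, arity). -/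
structure Atom where
  pred : ℕ
  args : List Const

/-- An argument in the defining atom of an intensional set or multiset which has no free
variable: a constant, the grouped variable, or a local variable. -/
inductive PTerm : Type
  | const (c : Const) : PTerm
  | grouped : PTerm
  | loc (j : ℕ) : PTerm

/-- The intensional set `{X | p(Y₁,…,Yₘ)}` (`multi = false`), or the intensional multiset
`{{X | ∃ Z₁,…,Zᵣ. p(Y₁,…,Yₘ)}}` (`multi = true`), where `X` is the grouped variable and
`Z₁,…,Zᵣ` are the local variables that occur among the `Yᵢ`. -/
structure ISet where
  multi : Bool
  pred : ℕ
  args : List PTerm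

/-- The relational operators `=, ≠, <, >, ≤, ≥`. -/
inductive RelOp : Type
  | eq | ne | lt | gt | le | ge

/-- A ground aggregate atom `aggr(s) op result`. -/
structure AggAtom where
  fn : ℕ
  iset : ISet
  op : RelOp
  result : ℤ

/-- A ground rule `head ← agg, pos, not neg`. -/
structure Rule where
  head : Atom
  agg : List AggAtom
  pos : List Atom
  neg : List Atom

/-- Ground atoms over given predicate symbols and constants. -/
def Atom.Over (a : Atom) (preds : List (ℕ × ℕ)) (consts : List Const) : Prop :=
  (a.pred, a.args.length) ∈ preds ∧ ∀ c ∈ a.args, c ∈ consts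

/-- The grouped variable occurs in the defining atom, an intensional set has no local
variables, and all symbols are from the program signature. -/
def ISet.Over (s : ISet) (preds : List (ℕ × ℕ)) (consts : List Const) : Prop :=
  (s.pred, s.args.length) ∈ preds ∧ PTerm.grouped ∈ s.args ∧
    (s.multi = false → ∀ j, PTerm.loc j ∉ s.args) ∧
    ∀ c, PTerm.const c ∈ s.args → c ∈ consts

def AggAtom.Over (l : AggAtom) (preds : List (ℕ × ℕ)) (consts : List Const) : Prop :=
  l.iset.Over preds consts ∧ Const.int l.result ∈ consts

def Rule.Over (r : Rule) (preds : List (ℕ × ℕ)) (consts : List Const) : Prop :=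
  r.head.Over preds consts ∧ (∀ l ∈ r.agg, l.Over preds consts) ∧
    (∀ a ∈ r.pos, a.Over preds consts) ∧ ∀ a ∈ r.neg, a.Over preds consts

/-- A ground program with aggregates, together with its finite signature: the constants
(which form the Herbrand universe) and the predicate symbols (name, arity). -/
structure Program where
  consts : List Const
  preds : List (ℕ × ℕ)
  rules : List Rule
  rules_over : ∀ r ∈ rules, r.Over preds consts

/-- The Herbrand base. -/
def Program.base (P : Program) : Set Atom := {a | a.Over P.preds P.consts}

/-- `ℓ` is one of the aggregate atoms occurring in the program. -/
def Program.HasAgg (P : Program) (l : AggAtom) : Prop := ∃ r ∈ P.rules, l ∈ r.agg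

/-! ### Semantics -/

/-- The fixed interpretation of the aggregate function symbols: an integer for every
finite set and every finite multiset of constants. -/
abbrev AggInterp := ℕ → Finset Const ⊕ Multiset Const → ℤ

def PTerm.subst (a : Const) (η : ℕ → Const) : PTerm → Const
  | .const c => c
  | .grouped => a
  | .loc j => η j

/-- The instance of the defining atom for `X/a` and `Zⱼ/η j`. -/
def ISet.inst (s : ISet) (a : Const) (η : ℕ → Const) : Atom :=
  ⟨s.pred, s.args.map (PTerm.subst a η)⟩

/-- The local variables. -/
def ISet.locals (s : ISet) : Finset ℕ :=
  (s.args.filterMap fun | .loc j => some j | _ => none).toFinset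

open Classical in
/-- Value of an intensional set in the interpretation `I` over the Herbrand universe `H`. -/
noncomputable def ISet.setVal (s : ISet) (H : Finset Const) (I : Set Atom) : Finset Const :=
  H.filter fun a => s.inst a (fun _ => a) ∈ I

open Classical in
/-- Value of an intensional multiset: one occurrence of `a` for every substitution of the
local variables by constants which, together with `X/a`, makes the defining atom true.
(The value `a` given to numbers that are not local variables plays no role.) -/
noncomputable def ISet.multisetVal (s : ISet) (H : Finset Const) (I : Set Atom) :
    Multiset Const :=
  ((H ×ˢ Fintype.piFinset fun _ : {j // j ∈ s.locals} => H).filter fun γ =>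
    s.inst γ.1 (fun j => if h : j ∈ s.locals then γ.2 ⟨j, h⟩ else γ.1) ∈ I).val.map Prod.fst

noncomputable def ISet.val (s : ISet) (H : Finset Const) (I : Set Atom) :
    Finset Const ⊕ Multiset Const :=
  if s.multi then .inr (s.multisetVal H I) else .inl (s.setVal H I)

def RelOp.Holds : RelOp → ℤ → ℤ → Prop
  | .eq, a, b => a = b
  | .ne, a, b => a ≠ b
  | .lt, a, b => a < b
  | .gt, a, b => a > b
  | .le, a, b => a ≤ b
  | .ge, a, b => a ≥ b

/-- `I ⊨ ℓ` for an interpretation `I` of `P` and an aggregate atom `ℓ`. -/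
def Program.Sat (P : Program) (ι : AggInterp) (I : Set Atom) (l : AggAtom) : Prop :=
  l.op.Holds (ι l.fn (l.iset.val P.consts.toFinset I)) l.result

/-- `𝓗(ℓ)`: the atoms built from the grouped predicate of `ℓ` and the Herbrand universe. -/
def Program.aggBase (P : Program) (l : AggAtom) : Set Atom :=
  {a | a.pred = l.iset.pred ∧ a.args.length = l.iset.args.length ∧ ∀ c ∈ a.args, c ∈ P.consts}

/-- `⟨S₁, S₂⟩` is an aggregate solution of `ℓ`. -/
def Program.IsSolution (P : Program) (ι : AggInterp) (l : AggAtom) (S₁ S₂ : Set Atom) : Prop :=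
  S₁ ⊆ P.aggBase l ∧ S₂ ⊆ P.aggBase l ∧ Disjoint S₁ S₂ ∧
    ∀ I ⊆ P.base, S₁ ⊆ I → S₂ ∩ I = ∅ → P.Sat ι I l

/-- The reduct of `P` with respect to `M`. -/
def Program.reduct (P : Program) (M : Set Atom) : Set Rule :=
  {r' | ∃ r ∈ P.rules, (∀ b ∈ r.neg, b ∉ M) ∧ r' = { r with neg := [] }}

/-- Conditional satisfaction of an aggregate atom with respect to `I` and `M`. -/
def Program.CondSat (P : Program) (ι : AggInterp) (I M : Set Atom) (l : AggAtom) : Prop :=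
  P.IsSolution ι l (I ∩ M ∩ P.aggBase l) (P.aggBase l \ M)

/-- The consequence operator. -/
def Program.K (P : Program) (ι : AggInterp) (M I : Set Atom) : Set Atom :=
  {a | ∃ r ∈ P.reduct M, a = r.head ∧ (∀ b ∈ r.pos, b ∈ I) ∧ ∀ l ∈ r.agg, P.CondSat ι I M l}

/-- `M` is a fixpoint answer set: an interpretation which is the least fixpoint of the
consequence operator among the interpretations of `P`. -/
def Program.IsFixpointAnswerSet (P : Program) (ι : AggInterp) (M : Set Atom) : Prop :=
  IsLeast {I | I ⊆ P.base ∧ P.K ι M I = I} M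

/-! ### Coding of instances as trees -/

namespace Sexp

def ofList {α : Type} (f : α → Sexp) (l : List α) : Sexp := l.foldr (fun a t => cons (f a) t) nil

/-- Binary notation, least significant bit first. -/
def ofNat (n : ℕ) : Sexp := ofList ofBool n.bits

def ofInt (z : ℤ) : Sexp := cons (ofBool (decide (z < 0))) (ofNat z.natAbs)

def ofConst : Const → Sexp
  | .int z => cons (ofBool false) (ofInt z)
  | .sym n => cons (ofBool true) (ofNat n)

def ofAtom (a : Atom) : Sexp := cons (ofNat a.pred) (ofList ofConst a.args)

def ofPTerm : PTerm → Sexp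
  | .const c => cons (ofNat 0) (ofConst c)
  | .grouped => cons (ofNat 1) nil
  | .loc j => cons (ofNat 2) (ofNat j)

def ofISet (s : ISet) : Sexp := cons (ofBool s.multi) (cons (ofNat s.pred) (ofList ofPTerm s.args))

def ofRelOp : RelOp → Sexp
  | .eq => ofNat 0
  | .ne => ofNat 1
  | .lt => ofNat 2
  | .gt => ofNat 3
  | .le => ofNat 4
  | .ge => ofNat 5

def ofAggAtom (l : AggAtom) : Sexp :=
  cons (ofNat l.fn) (cons (ofISet l.iset) (cons (ofRelOp l.op) (ofInt l.result)))

def ofRule (r : Rule) : Sexp :=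
  cons (ofAtom r.head)
    (cons (ofList ofAggAtom r.agg) (cons (ofList ofAtom r.pos) (ofList ofAtom r.neg)))

def ofProgram (P : Program) : Sexp :=
  cons (ofList ofConst P.consts)
    (cons (ofList (fun p : ℕ × ℕ => cons (ofNat p.1) (ofNat p.2)) P.preds)
      (ofList ofRule P.rules))

/-- Instance "aggregate atom `ℓ`, interpretation given by the list `M` of its atoms". -/
def ofTruthQuery (l : AggAtom) (M : List Atom) : Sexp := cons (ofAggAtom l) (ofList ofAtom M)

end Sexp

/-! ### `C`-decidability -/

/-- The oracle `A` decides the truth value of the aggregate atom `ℓ` with respect to the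
interpretations `M` of `P`. -/
def Program.AggDecidedBy (P : Program) (ι : AggInterp) (A : Lang) (l : AggAtom) : Prop :=
  ∀ M : List Atom, {a | a ∈ M} ⊆ P.base →
    (Sexp.ofTruthQuery l M ∈ A ↔ P.Sat ι {a | a ∈ M} l)

/-- The programs in `𝒬` are `𝒞`-decidable: an oracle from the class `𝒞` decides the truth
values of the aggregate atoms occurring in them. (A single finite program has only finitely
many truth values; as complexity is about all instances, the oracle is one for all of `𝒬`.) -/
def ClassDecidable (ι : AggInterp) (𝒞 : Set Lang) (𝒬 : Set Program) : Prop :=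
  ∃ A ∈ 𝒞, ∀ P ∈ 𝒬, ∀ l, P.HasAgg l → P.AggDecidedBy ι A l

/-- A decision problem on a set `𝒬` of programs belongs to the class `𝒦` of languages:
some language in `𝒦` answers it correctly on the codes of all programs in `𝒬`. -/
def ProblemIn (𝒦 : Set Lang) (𝒬 : Set Program) (yes : Program → Prop) : Prop :=
  ∃ L ∈ 𝒦, ∀ P ∈ 𝒬, (Sexp.ofProgram P ∈ L ↔ yes P)

/-! ### Functions computable in polynomial time with an oracle -/

/-! The problem has the form "there is a short `w` such that every short `u` satisfies a condition
decidable in polynomial time with the oracle `A`", and `mem_NPRel_coNPRel` places such languages in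
the required class.

The certificate `w` is a derivation: a list of program rules, latest first, each firing with respect
to `M` and the heads of the rules behind it, where `M` is the set of all heads of `w`. An answer set
has a derivation no longer than the program (`exists_derivation`). Conversely, the heads of a
derivation lie in every fixpoint, so they form an answer set once they are closed under the rules
(`Derivation.isFixpointAnswerSet`).

The only costly test is conditional satisfaction. By `condSat_iff` it says that the aggregate atom
holds in every `J` with `I ⊆ J ⊆ M`. One universally quantified `u`, read as a listing of `J`,
therefore serves all steps of the derivation. For closure, `I = M` leaves `J = M` only, so a failing
aggregate is detected by a plain query and the quantifier over `u` does not have to alternate.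

Programs are not written by hand: `PolyTime` and `PolyDec` are shown closed under composition,
branching, a loop principle and bounded quantification, and the verifier is assembled from these. -/

theorem Polynomial.eval_mono_nat (p : Polynomial ℕ) {m n : ℕ} (h : m ≤ n) :
    p.eval m ≤ p.eval n := by
  rw [Polynomial.eval_eq_sum, Polynomial.eval_eq_sum]
  exact Finset.sum_le_sum fun i _ => Nat.mul_le_mul_left _ (Nat.pow_le_pow_left h i)

/-- `f` is computed in polynomial time with oracle `O`: for all choices of an input register `i`
and an output register `j` below a bound `m`, some program computes `f` from `i` into `j`
leaving the other registers below `m` unchanged. -/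
def PolyTime (O : Lang) (f : Sexp → Sexp) : Prop :=
  ∃ p : Polynomial ℕ, (∀ x, (f x).size ≤ p.eval x.size) ∧
    ∀ m i j, i < m → j < m → ∃ c : Cmd, ∀ s : Store, ∃ (t : ℕ) (s' : Store),
      Exec O c s t s' ∧ t ≤ p.eval (s i).size ∧ s' j = f (s i) ∧ ∀ k < m, k ≠ j → s' k = s k

@[simp] theorem Sexp.hd_nil : Sexp.nil.hd = .nil := rfl

@[simp] theorem Sexp.tl_nil : Sexp.nil.tl = .nil := rfl

@[simp] theorem Sexp.hd_cons (a b : Sexp) : (Sexp.cons a b).hd = a := rfl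

@[simp] theorem Sexp.tl_cons (a b : Sexp) : (Sexp.cons a b).tl = b := rfl

theorem Sexp.size_pos (x : Sexp) : 0 < x.size := by
  cases x <;> simp only [Sexp.size] <;> omega

theorem Sexp.size_hd_le (x : Sexp) : x.hd.size ≤ x.size := by
  cases x <;> simp only [Sexp.size, Sexp.hd] <;> omega

theorem Sexp.size_tl_le (x : Sexp) : x.tl.size ≤ x.size := by
  cases x <;> simp only [Sexp.size, Sexp.tl] <;> omega

theorem Sexp.size_ofBool_le (b : Bool) : (Sexp.ofBool b).size ≤ 3 := by
  cases b <;> simp [Sexp.ofBool, Sexp.size]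

theorem Sexp.ofBool_ne_nil {b : Bool} : Sexp.ofBool b ≠ .nil ↔ b = true := by
  cases b <;> simp [Sexp.ofBool]

namespace PolyTime

variable {O : Lang} {f g h : Sexp → Sexp}

theorem id : PolyTime O (fun x => x) := by
  refine ⟨.X + 1, fun x => by simp, fun m i j _ _ => ⟨.copy j i, fun s =>
    ⟨_, _, .copy j i s, by simp [add_comm], by simp, fun k _ hk => by simp [hk]⟩⟩⟩

theorem const_nil : PolyTime O (fun _ => .nil) := by
  refine ⟨1, fun x => by simp [Sexp.size], fun m i j _ _ => ⟨.setNil j, fun s =>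
    ⟨_, _, .setNil j s, by simp, by simp, fun k _ hk => by simp [hk]⟩⟩⟩

theorem congr (hf : PolyTime O f) (h : ∀ x, f x = g x) : PolyTime O g := funext h ▸ hf

/-- Registers from `m` on are scratch. The intermediate value goes to register `m`; asking for bound
`m + 1` keeps the other registers below `m`, and hence the input, intact. -/
theorem comp (hg : PolyTime O g) (hf : PolyTime O f) : PolyTime O (fun x => g (f x)) := by
  obtain ⟨p, hp, hf⟩ := hf
  obtain ⟨q, hq, hg⟩ := hg
  refine ⟨p + q.comp p, fun x => ?_, fun m i j hi hj => ?_⟩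
  · have := (hq (f x)).trans (q.eval_mono_nat (hp x))
    simp only [Polynomial.eval_add, Polynomial.eval_comp]
    omega
  · obtain ⟨c, hc⟩ := hf (m + 1) i m (by omega) (by omega)
    obtain ⟨d, hd⟩ := hg (m + 1) m j (by omega) (by omega)
    refine ⟨.seq c d, fun s => ?_⟩
    obtain ⟨t, s', e, ht, ho, hk⟩ := hc s
    obtain ⟨t', s'', e', ht', ho', hk'⟩ := hd s'
    refine ⟨_, _, .seq e e', ?_, by rw [ho', ho], fun k hkm hkj => ?_⟩
    · rw [ho] at ht'
      have := ht'.trans (q.eval_mono_nat (hp (s i)))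
      simp only [Polynomial.eval_add, Polynomial.eval_comp]
      omega
    · rw [hk' k (by omega) hkj, hk k (by omega) (by omega)]

theorem hd (hf : PolyTime O f) : PolyTime O (fun x => (f x).hd) := by
  refine comp (g := Sexp.hd) ⟨.X + 1, fun x => ?_, fun m i j _ _ => ⟨.hd j i, fun s =>
    ⟨_, _, .hd j i s, ?_, by simp, fun k _ hk => by simp [hk]⟩⟩⟩ hf
  · have := x.size_hd_le
    simp; omega
  · have := (s i).size_hd_le
    simp; omega

theorem tl (hf : PolyTime O f) : PolyTime O (fun x => (f x).tl) := by
  refine comp (g := Sexp.tl) ⟨.X + 1, fun x => ?_, fun m i j _ _ => ⟨.tl j i, fun s =>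
    ⟨_, _, .tl j i s, ?_, by simp, fun k _ hk => by simp [hk]⟩⟩⟩ hf
  · have := x.size_tl_le
    simp; omega
  · have := (s i).size_tl_le
    simp; omega

open Classical in
theorem query (hf : PolyTime O f) : PolyTime O (fun x => .ofBool (decide (f x ∈ O))) := by
  refine comp (g := fun x => .ofBool (decide (x ∈ O))) ⟨.X + 3, fun x => ?_, fun m i j _ _ =>
    ⟨.query j i, fun s => ⟨_, _, .query j i s, ?_, by simp, fun k _ hk => by simp [hk]⟩⟩⟩ hf
  · have := Sexp.size_ofBool_le (decide (x ∈ O))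
    simp only [Polynomial.eval_add, Polynomial.eval_X, Polynomial.eval_ofNat]; omega
  · simp; omega

theorem cons (hf : PolyTime O f) (hg : PolyTime O g) :
    PolyTime O (fun x => .cons (f x) (g x)) := by
  obtain ⟨p, hp, hf⟩ := hf
  obtain ⟨q, hq, hg⟩ := hg
  refine ⟨2 * p + 2 * q + 2, fun x => ?_, fun m i j hi hj => ?_⟩
  · have h₁ := hp x
    have h₂ := hq x
    simp [Sexp.size]
    omega
  · obtain ⟨c, hc⟩ := hf (m + 1) i m (by omega) (by omega)
    -- The bound `m + 2` protects the value of `f` in register `m` while `g` is computed.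
    obtain ⟨d, hd⟩ := hg (m + 2) i (m + 1) (by omega) (by omega)
    refine ⟨.seq c (.seq d (.cons j m (m + 1))), fun s => ?_⟩
    obtain ⟨t, s', e, ht, ho, hk⟩ := hc s
    obtain ⟨t', s'', e', ht', ho', hk'⟩ := hd s'
    have hi' := hk i (by omega) (by omega)
    have hm := hk' m (by omega) (by omega)
    refine ⟨_, _, .seq e (.seq e' (.cons j m (m + 1) s'')), ?_, ?_, fun k hkm hkj => ?_⟩
    · rw [hm, ho', ho, hi']
      rw [hi'] at ht'
      have h₁ := hp (s i)
      have h₂ := hq (s i)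
      simp [Sexp.size]
      omega
    · simp [hm, ho', ho, hi']
    · rw [Function.update_of_ne hkj, hk' k (by omega) (by omega), hk k (by omega) (by omega)]

open Classical in
theorem ite (hf : PolyTime O f) (hg : PolyTime O g) (hh : PolyTime O h) :
    PolyTime O (fun x => if f x ≠ .nil then g x else h x) := by
  obtain ⟨p, hp, hf⟩ := hf
  obtain ⟨q, hq, hg⟩ := hg
  obtain ⟨r, hr, hh⟩ := hh
  refine ⟨p + q + r + 1, fun x => ?_, fun m i j hi hj => ?_⟩
  · have h₁ := hq x
    have h₂ := hr x
    simp only [Polynomial.eval_add, Polynomial.eval_one]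
    split_ifs <;> omega
  · obtain ⟨c, hc⟩ := hf (m + 1) i m (by omega) (by omega)
    obtain ⟨d, hd⟩ := hg m i j hi hj
    obtain ⟨d', hd'⟩ := hh m i j hi hj
    refine ⟨.seq c (.ite m d d'), fun s => ?_⟩
    obtain ⟨t, s', e, ht, ho, hk⟩ := hc s
    have hi' := hk i (by omega) (by omega)
    simp only [Polynomial.eval_add, Polynomial.eval_one]
    by_cases hm : f (s i) = .nil
    · obtain ⟨t', s'', e', ht', ho', hk'⟩ := hd' s'
      rw [hi'] at ht' ho'
      refine ⟨_, _, .seq e (.iteFalse (ho.trans hm) e'), by omega, by simp [hm, ho'],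
        fun k hkm hkj => ?_⟩
      rw [hk' k hkm hkj, hk k (by omega) (by omega)]
    · obtain ⟨t', s'', e', ht', ho', hk'⟩ := hd s'
      rw [hi'] at ht' ho'
      refine ⟨_, _, .seq e (.iteTrue (by rwa [ho]) e'), by omega, by simp [hm, ho'],
        fun k hkm hkj => ?_⟩
      rw [hk' k hkm hkj, hk k (by omega) (by omega)]

theorem ofBool (b : Bool) : PolyTime O (fun _ => .ofBool b) := by
  cases b
  · exact const_nil
  · exact cons const_nil const_nil

/-- The state sits in register `m`; its left component is mirrored in `m + 1`, since a loop can only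
test a whole register. A round costs at most one step for the test, `p.eval B` for the body and `1 +
B` for refreshing the mirror. -/
theorem exec_loop {Inv : Sexp → Prop} {μ : Sexp → ℕ} {m B : ℕ} {c : Cmd} {p : Polynomial ℕ}
    (hc : ∀ s : Store, ∃ (t : ℕ) (s' : Store), Exec O c s t s' ∧ t ≤ p.eval (s m).size ∧
      s' m = f (s m) ∧ ∀ k < m + 2, k ≠ m → s' k = s k)
    (hB : ∀ z, Inv z → z.size ≤ B)
    (hstep : ∀ z, Inv z → z.hd ≠ .nil → Inv (f z) ∧ μ (f z) < μ z) :
    ∀ n (s : Store), μ (s m) ≤ n → Inv (s m) → s (m + 1) = (s m).hd →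
      ∃ (t : ℕ) (s' : Store), Exec O (.loop (m + 1) (.seq c (.hd (m + 1) m))) s t s' ∧
        t ≤ 1 + n * (2 + p.eval B + B) ∧ Inv (s' m) ∧ (s' m).hd = .nil ∧
        ∀ k < m, s' k = s k := by
  intro n
  induction n with
  | zero =>
    intro s hn hI hs
    have hnil : s (m + 1) = .nil := by
      by_contra h
      have := (hstep _ hI (hs ▸ h)).2
      omega
    exact ⟨_, _, .loopStop hnil, by simp, hI, hs ▸ hnil, fun _ _ => rfl⟩
  | succ n ih =>
    intro s hn hI hs
    by_cases hnil : s (m + 1) = .nil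
    · exact ⟨_, _, .loopStop hnil, by simp, hI, hs ▸ hnil, fun _ _ => rfl⟩
    · obtain ⟨hI', hμ⟩ := hstep _ hI (hs ▸ hnil)
      obtain ⟨t, s', e, ht, ho, hk⟩ := hc s
      obtain ⟨t', s'', e', ht', hI'', hnil', hk'⟩ :=
        ih (Function.update s' (m + 1) (s' m).hd) (by simp [ho]; omega) (by simpa [ho])
          (by simp)
      refine ⟨_, _, .loopStep hnil (.seq e (.hd _ _ _)) e', ?_, hI'', hnil', fun k hkm => ?_⟩
      · have h₁ := ht.trans (p.eval_mono_nat (hB _ hI))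
        have h₂ := (s' m).size_hd_le.trans (ho ▸ hB _ hI')
        rw [add_one_mul]
        omega
      · rw [hk' k hkm, Function.update_of_ne (by omega), hk k (by omega) (by omega)]

/-- Loops: iterate `f` on a state until its left component is `nil`. The invariant may refer to
the input, the measure bounds the number of iterations. -/
theorem loop {a out F : Sexp → Sexp} {Inv : Sexp → Sexp → Prop} {μ : Sexp → ℕ}
    (ha : PolyTime O a) (hf : PolyTime O f) (hout : PolyTime O out) (q : Polynomial ℕ)
    (hinit : ∀ x, Inv x (a x))
    (hbound : ∀ x z, Inv x z → z.size ≤ q.eval x.size ∧ μ z ≤ q.eval x.size)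
    (hstep : ∀ x z, Inv x z → z.hd ≠ .nil → Inv x (f z) ∧ μ (f z) < μ z)
    (hend : ∀ x z, Inv x z → z.hd = .nil → out z = F x) : PolyTime O F := by
  obtain ⟨pa, hpa, ha⟩ := ha
  obtain ⟨p, hp, hf⟩ := hf
  obtain ⟨r, hr, hout⟩ := hout
  -- The output size must be bounded without reference to a run: iterating `f` abstractly gives a
  -- final state within the invariant, and `out` of it is `F x`.
  have hF : ∀ x, ∃ z, Inv x z ∧ out z = F x := by
    intro x
    suffices ∀ n z, μ z ≤ n → Inv x z → ∃ z, Inv x z ∧ out z = F x from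
      this _ _ le_rfl (hinit x)
    intro n
    induction n with
    | zero =>
      intro z hz hI
      refine ⟨z, hI, hend x z hI ?_⟩
      by_contra h
      have := (hstep x z hI h).2
      omega
    | succ n ih =>
      intro z hz hI
      by_cases h : z.hd = .nil
      · exact ⟨z, hI, hend x z hI h⟩
      · obtain ⟨h₁, h₂⟩ := hstep x z hI h
        exact ih _ (by omega) h₁
  refine ⟨pa + (1 + q) + (1 + q * (2 + p.comp q + q)) + r.comp q, fun x => ?_,
    fun m i j hi hj => ?_⟩
  · obtain ⟨z, hz, hzF⟩ := hF x
    have := (hr z).trans (r.eval_mono_nat (hbound x z hz).1)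
    simp only [Polynomial.eval_add, Polynomial.eval_comp]
    rw [← hzF]
    omega
  · obtain ⟨ca, hca⟩ := ha (m + 1) i m (by omega) (by omega)
    obtain ⟨c, hc⟩ := hf (m + 2) m m (by omega) (by omega)
    obtain ⟨d, hd⟩ := hout (m + 1) m j (by omega) (by omega)
    refine ⟨.seq ca (.seq (.hd (m + 1) m) (.seq (.loop (m + 1) (.seq c (.hd (m + 1) m))) d)),
      fun s => ?_⟩
    obtain ⟨t, s', e, ht, ho, hk⟩ := hca s
    obtain ⟨t₁, s₁, e₁, ht₁, hI₁, hnil₁, hk₁⟩ := exec_loop (Inv := Inv (s i)) (μ := μ) hc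
      (fun z hz => (hbound _ z hz).1) (hstep (s i)) (q.eval (s i).size)
      (Function.update s' (m + 1) (s' m).hd)
      (by simpa [ho] using (hbound _ _ (hinit _)).2) (by simpa [ho] using hinit _) (by simp)
    obtain ⟨t₂, s₂, e₂, ht₂, ho₂, hk₂⟩ := hd s₁
    refine ⟨_, _, .seq e (.seq (.hd _ _ _) (.seq e₁ e₂)), ?_, ?_, fun k hkm hkj => ?_⟩
    · have h₁ := ht₂.trans (r.eval_mono_nat (hbound _ _ hI₁).1)
      have h₂ := (s' m).size_hd_le.trans (ho ▸ (hbound _ _ (hinit (s i))).1)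
      simp only [Polynomial.eval_add, Polynomial.eval_comp, Polynomial.eval_mul,
        Polynomial.eval_one, Polynomial.eval_ofNat]
      omega
    · rw [ho₂, hend _ _ hI₁ hnil₁]
    · rw [hk₂ k (by omega) hkj, hk₁ k hkm, Function.update_of_ne (by omega),
        hk k (by omega) (by omega)]

end PolyTime

/-! ### Predicates decidable in polynomial time with an oracle -/

open Classical in
/-- The predicate `S` is decided in polynomial time with oracle `O`. -/
def PolyDec (O : Lang) (S : Sexp → Prop) : Prop :=
  PolyTime O (fun x => .ofBool (decide (S x)))

/-- The members of a tree, read as a list. -/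
def Sexp.toList : Sexp → List Sexp
  | .nil => []
  | .cons a b => a :: b.toList

/-- Some nonempty final segment of the list `x` has the property `p`. -/
def Sexp.ExTail (p : Sexp → Prop) : Sexp → Prop
  | .nil => False
  | .cons a b => p (.cons a b) ∨ Sexp.ExTail p b

/-- All nonempty final segments of the list `x` have the property `p`. -/
def Sexp.AllTail (p : Sexp → Prop) : Sexp → Prop
  | .nil => True
  | .cons a b => p (.cons a b) ∧ Sexp.AllTail p b

theorem Sexp.exTail_hd_iff {p : Sexp → Prop} (x : Sexp) :
    x.ExTail (fun t => p t.hd) ↔ ∃ a ∈ x.toList, p a := by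
  induction x with
  | nil => simp [ExTail, toList]
  | cons a b _ ih => simp [ExTail, toList, ih]

theorem Sexp.not_exTail_not {p : Sexp → Prop} (x : Sexp) :
    ¬ x.ExTail (fun t => ¬ p t) ↔ x.AllTail p := by
  induction x with
  | nil => simp [ExTail, AllTail]
  | cons a b _ ih => simp [ExTail, AllTail, ← ih]

/-- Total size of the members of a list. -/
def Sexp.weight : Sexp → ℕ
  | .nil => 0
  | .cons a b => a.size + b.weight

theorem Sexp.weight_le_size (x : Sexp) : x.weight ≤ x.size := by
  induction x with
  | nil => simp [weight]
  | cons a b _ ih => simp only [weight, size]; omega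

namespace PolyDec

variable {O : Lang} {S T : Sexp → Prop} {f g : Sexp → Sexp}

theorem comp (hS : PolyDec O S) (hf : PolyTime O f) : PolyDec O (fun x => S (f x)) :=
  PolyTime.comp hS hf

theorem congr (hS : PolyDec O S) (h : ∀ x, S x ↔ T x) : PolyDec O T := by
  rwa [show T = S from funext fun x => propext (h x).symm]

open Classical in
theorem ite (hS : PolyDec O S) (hf : PolyTime O f) (hg : PolyTime O g) :
    PolyTime O (fun x => if S x then f x else g x) := by
  simpa [Sexp.ofBool_ne_nil] using PolyTime.ite hS hf hg

theorem not (hS : PolyDec O S) : PolyDec O (fun x => ¬ S x) := by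
  refine (ite hS (.ofBool false) (.ofBool true)).congr fun x => ?_
  by_cases h : S x <;> simp [h]

theorem and (hS : PolyDec O S) (hT : PolyDec O T) : PolyDec O (fun x => S x ∧ T x) := by
  refine (ite hS hT (.ofBool false)).congr fun x => ?_
  by_cases h : S x
  · rw [if_pos h]
    exact congrArg Sexp.ofBool (decide_eq_decide.mpr (by simp [h]))
  · simp [h]

theorem or (hS : PolyDec O S) (hT : PolyDec O T) : PolyDec O (fun x => S x ∨ T x) :=
  congr (not (and (not hS) (not hT))) fun x => by tauto

theorem imp (hS : PolyDec O S) (hT : PolyDec O T) : PolyDec O (fun x => S x → T x) :=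
  congr (or (not hS) hT) fun x => by tauto

theorem query (hf : PolyTime O f) : PolyDec O (fun x => f x ∈ O) := PolyTime.query hf

open Classical in
theorem exTail {p : Sexp → Sexp → Prop} (hf : PolyTime O f)
    (hp : PolyDec O (fun z => p z.hd z.tl)) :
    PolyDec O (fun x => (f x).ExTail (fun t => p t x)) := by
  obtain ⟨q, hq, -⟩ := id hf
  have hx : PolyTime O (fun z => z.tl.tl) := .tl (.tl .id)
  -- The state holds the remaining list, a flag for success, and the input. Success empties the
  -- list, so the loop stops at once.
  refine PolyTime.loop (a := fun x => .cons (f x) (.cons (.ofBool (false)) x))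
    (f := fun z => if p z.hd z.tl.tl then .cons .nil (.cons (.ofBool (true)) z.tl.tl)
      else .cons z.hd.tl (.cons (.ofBool (false)) z.tl.tl))
    (out := fun z => z.tl.hd)
    (Inv := fun x z => ∃ l b, z = .cons l (.cons (.ofBool b) x) ∧ l.size ≤ (f x).size ∧
      ((f x).ExTail (fun t => p t x) ↔ b = true ∨ l.ExTail (fun t => p t x)) ∧
      (b = true → l = .nil))
    (μ := fun z => z.hd.size)
    (.cons hf (.cons (.ofBool false) .id))
    (ite (comp hp (.cons (.hd .id) hx)) (.cons .const_nil (.cons (.ofBool true) hx))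
      (.cons (.tl (.hd .id)) (.cons (.ofBool false) hx)))
    (.hd (.tl .id)) (q + .X + 5) ?_ ?_ ?_ ?_
  · exact fun x => ⟨f x, false, rfl, le_rfl, by simp, by simp⟩
  · rintro x _ ⟨l, b, rfl, hl, -, -⟩
    have h₁ := hq x
    have h₂ := Sexp.size_ofBool_le b
    simp only [Sexp.size, Sexp.hd_cons, Polynomial.eval_add, Polynomial.eval_X,
      Polynomial.eval_ofNat]
    omega
  · rintro x _ ⟨l, b, rfl, hl, hiff, hb⟩ hne
    cases l with
    | nil => exact absurd rfl hne
    | cons a l =>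
      have hbf : b = false := by cases b <;> simp_all
      subst hbf
      have := a.size_pos
      have := l.size_pos
      split_ifs with h <;> simp only [Sexp.hd_cons, Sexp.tl_cons] at h
      · refine ⟨⟨.nil, _, rfl, ?_, ?_, by simp⟩, ?_⟩
        · simp only [Sexp.size] at *; omega
        · simp [hiff, Sexp.ExTail, h]
        · simp only [Sexp.size, Sexp.hd_cons, Sexp.tl_cons]; omega
      · refine ⟨⟨l, _, rfl, ?_, ?_, by simp⟩, ?_⟩
        · simp only [Sexp.size] at *; omega
        · simp [hiff, Sexp.ExTail, h]
        · simp only [Sexp.size, Sexp.hd_cons, Sexp.tl_cons]; omega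
  · rintro x _ ⟨l, b, rfl, hl, hiff, hb⟩ hnil
    simp only [Sexp.hd_cons] at hnil
    subst hnil
    simp [hiff, Sexp.ExTail]

theorem allTail {p : Sexp → Sexp → Prop} (hf : PolyTime O f)
    (hp : PolyDec O (fun z => p z.hd z.tl)) :
    PolyDec O (fun x => (f x).AllTail (fun t => p t x)) :=
  congr (not (exTail (p := fun t x => ¬ p t x) hf (not hp))) fun x => (f x).not_exTail_not

theorem exists_mem {p : Sexp → Sexp → Prop} (hf : PolyTime O f)
    (hp : PolyDec O (fun z => p z.hd z.tl)) :
    PolyDec O (fun x => ∃ a ∈ (f x).toList, p a x) :=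
  congr (exTail (p := fun t x => p t.hd x) hf (comp hp (.cons (.hd (.hd .id)) (.tl .id))))
    fun x => (f x).exTail_hd_iff (p := fun t => p t x)

theorem forall_mem {p : Sexp → Sexp → Prop} (hf : PolyTime O f)
    (hp : PolyDec O (fun z => p z.hd z.tl)) :
    PolyDec O (fun x => ∀ a ∈ (f x).toList, p a x) :=
  congr (not (exists_mem (p := fun t x => ¬ p t x) hf (not hp))) fun x => by
    push Not; rfl

open Classical in
-- Trees are compared with a stack of pairs still to be matched. Splitting a pair of `cons` nodes
-- leaves the size of the stack unchanged but lowers its `weight` by one, so size bounds the space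
-- and weight the number of rounds. A mismatch empties the stack with the flag false (`nil`).
theorem eq (hf : PolyTime O f) (hg : PolyTime O g) : PolyDec O (fun x => f x = g x) := by
  obtain ⟨p, hp, -⟩ := id hf
  obtain ⟨q, hq, -⟩ := id hg
  have hl : PolyTime O (fun z => z.hd.hd.hd) := .hd (.hd (.hd .id))
  have hr : PolyTime O (fun z => z.hd.hd.tl) := .tl (.hd (.hd .id))
  have ht : PolyTime O (fun z => z.hd.tl) := .tl (.hd .id)
  refine PolyTime.loop
    (a := fun x => .cons (.cons (.cons (f x) (g x)) .nil) (.ofBool (true)))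
    (f := fun z => if z.hd.hd.hd ≠ .nil then
        if z.hd.hd.tl ≠ .nil then
          .cons (.cons (.cons z.hd.hd.hd.hd z.hd.hd.tl.hd)
            (.cons (.cons z.hd.hd.hd.tl z.hd.hd.tl.tl) z.hd.tl)) z.tl
        else .cons .nil .nil
      else if z.hd.hd.tl ≠ .nil then .cons .nil .nil else .cons z.hd.tl z.tl)
    (out := fun z => z.tl)
    (Inv := fun x z => ∃ l b, z = .cons l (.ofBool b) ∧
      l.size ≤ 3 + (f x).size + (g x).size ∧
      (f x = g x ↔ b = true ∧ ∀ a ∈ l.toList, a.hd = a.tl))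
    (μ := fun z => z.hd.weight)
    (.cons (.cons (.cons hf hg) .const_nil) (.ofBool true))
    (.ite hl (.ite hr (.cons (.cons (.cons (.hd hl) (.hd hr))
      (.cons (.cons (.tl hl) (.tl hr)) ht)) (.tl .id)) (.cons .const_nil .const_nil))
      (.ite hr (.cons .const_nil .const_nil) (.cons ht (.tl .id))))
    (.tl .id) (p + q + 7) ?_ ?_ ?_ ?_
  · refine fun x => ⟨_, true, rfl, ?_, ?_⟩
    · simp only [Sexp.size]; omega
    · simp [Sexp.toList]
  · rintro x _ ⟨l, b, rfl, hl, -⟩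
    have h₁ := hp x
    have h₂ := hq x
    have h₃ := Sexp.size_ofBool_le b
    have h₄ := l.weight_le_size
    simp only [Sexp.size, Sexp.hd_cons, Polynomial.eval_add, Polynomial.eval_ofNat]
    omega
  · rintro x _ ⟨l, b, rfl, hl, hiff⟩ hne
    simp only [Sexp.hd_cons, Sexp.tl_cons] at hne ⊢
    have hfalse : f x ≠ g x → ((∃ l b', Sexp.cons .nil .nil = .cons l (.ofBool b') ∧
        l.size ≤ 3 + (f x).size + (g x).size ∧
        (f x = g x ↔ b' = true ∧ ∀ a ∈ l.toList, a.hd = a.tl))) := fun h =>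
      ⟨.nil, false, rfl, by simp only [Sexp.size]; omega, by simp [h]⟩
    rcases l with _ | ⟨(_ | ⟨(_ | ⟨a, a'⟩), (_ | ⟨b, b'⟩)⟩), l⟩
    · exact absurd rfl hne
    · refine ⟨⟨l, b, by simp, ?_, ?_⟩, ?_⟩
      · simp only [Sexp.size] at hl; omega
      · simpa [Sexp.toList] using hiff
      · simp [Sexp.weight, Sexp.size]
    · refine ⟨⟨l, b, by simp, ?_, ?_⟩, ?_⟩
      · simp only [Sexp.size] at hl; omega
      · simpa [Sexp.toList] using hiff
      · simp [Sexp.weight, Sexp.size]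
    · refine ⟨by simpa using hfalse (by simp [hiff, Sexp.toList]), ?_⟩
      simp [Sexp.weight, Sexp.size]
    · refine ⟨by simpa using hfalse (by simp [hiff, Sexp.toList]), ?_⟩
      simp [Sexp.weight, Sexp.size]
    · rename_i v
      refine ⟨⟨.cons (.cons a b) (.cons (.cons a' b') l), v, by simp,
        ?_, ?_⟩, ?_⟩
      · simp only [Sexp.size] at hl ⊢; omega
      · rw [hiff]
        simp [Sexp.toList, and_assoc]
      · simp [Sexp.weight, Sexp.size]
        omega
  · rintro x _ ⟨l, b, rfl, hl, hiff⟩ hnil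
    simp only [Sexp.hd_cons] at hnil
    subst hnil
    simp [hiff, Sexp.toList]

theorem mem_PWith (hS : PolyDec O S) : {x | S x} ∈ PWith O := by
  obtain ⟨p, -, h⟩ := hS
  obtain ⟨c, hc⟩ := h 1 0 0 one_pos one_pos
  refine ⟨c, p, fun x => ?_⟩
  obtain ⟨t, s, e, ht, ho, -⟩ := hc (initStore x)
  have h0 : initStore x 0 = x := by simp [initStore]
  rw [h0] at ht ho
  exact ⟨t, s, e, ht, by rw [ho, Sexp.ofBool_ne_nil]; simp⟩

end PolyDec

/-- Languages defined by a pair of polynomially bounded quantifiers in front of a predicate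
that is decidable in polynomial time with an oracle. -/
theorem mem_NPRel_coNPRel {A : Lang} {𝒞 : Set Lang} (hA : A ∈ 𝒞) {G : Sexp → Prop}
    (hG : PolyDec A G) (q r : Polynomial ℕ) :
    {x | ∃ w : Sexp, w.size ≤ q.eval x.size ∧
      ∀ u : Sexp, u.size ≤ r.eval (Sexp.cons x w).size → G (.cons (.cons x w) u)} ∈
      NPRel (coNPRel 𝒞) := by
  -- The inner quantifier becomes the oracle language, whose complement has `u` as certificate; the
  -- outer verifier asks a single query about the pair of input and `w`.
  refine ⟨{y | ∀ u : Sexp, u.size ≤ r.eval y.size → G (.cons y u)},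
    ⟨A, hA, _, hG.not.mem_PWith, r, fun y => ?_⟩, _, (PolyDec.query .id).mem_PWith, q,
    fun x => Iff.rfl⟩
  simp

/-! ### Derivations and fixpoint answer sets -/

namespace Program

variable {P : Program} {ι : AggInterp} {l : AggAtom} {I J M : Set Atom} {r : Rule} {rs : List Rule}

theorem inst_mem_aggBase {η : ℕ → Const} {a : Const} (hl : l.Over P.preds P.consts)
    (ha : a ∈ P.consts) (hη : ∀ j, PTerm.loc j ∈ l.iset.args → η j ∈ P.consts) :
    l.iset.inst a η ∈ P.aggBase l := by
  refine ⟨rfl, by simp [ISet.inst], fun c hc => ?_⟩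
  obtain ⟨t, ht, rfl⟩ := List.mem_map.mp hc
  cases t with
  | const c => exact hl.1.2.2.2 c ht
  | grouped => exact ha
  | loc j => exact hη j ht

open Classical in
-- Evaluating the intensional set or multiset only inspects instances by constants of the program,
-- and all of these belong to `P.aggBase l`.
theorem sat_congr (hl : l.Over P.preds P.consts) (h : ∀ a ∈ P.aggBase l, a ∈ I ↔ a ∈ J) :
    P.Sat ι I l ↔ P.Sat ι J l := by
  have hset : l.iset.multi = false →
      l.iset.setVal P.consts.toFinset I = l.iset.setVal P.consts.toFinset J := fun hm =>
    Finset.filter_congr fun a ha => h _ <| inst_mem_aggBase hl (by simpa using ha)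
      fun j hj => absurd hj (hl.1.2.2.1 hm j)
  have hmulti : l.iset.multisetVal P.consts.toFinset I =
      l.iset.multisetVal P.consts.toFinset J := by
    unfold ISet.multisetVal
    refine congrArg (fun s : Finset _ => s.val.map Prod.fst) (Finset.filter_congr fun γ hγ => ?_)
    rw [Finset.mem_product, Fintype.mem_piFinset] at hγ
    refine h _ (inst_mem_aggBase hl (by simpa using hγ.1) fun j hj => ?_)
    have hj' : j ∈ l.iset.locals := by
      simp only [ISet.locals, List.mem_toFinset, List.mem_filterMap]
      exact ⟨_, hj, rfl⟩
    simpa [hj'] using hγ.2 ⟨j, hj'⟩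
  have : l.iset.val P.consts.toFinset I = l.iset.val P.consts.toFinset J := by
    unfold ISet.val
    split_ifs with hm
    · rw [hmulti]
    · rw [hset (by simpa using hm)]
  rw [Sat, Sat, this]

/-- A larger `I` forces more atoms to be true, so fewer interpretations remain to be tested. -/
theorem CondSat.mono (h : I ⊆ J) (hI : P.CondSat ι I M l) : P.CondSat ι J M l := by
  refine ⟨Set.inter_subset_right, hI.2.1, ?_, fun K hK hJK hMK => hI.2.2.2 K hK ?_ hMK⟩
  · exact Set.disjoint_left.mpr fun a ha ha' => ha'.2 ha.1.2
  · exact fun a ha => hJK ⟨⟨h ha.1.1, ha.1.2⟩, ha.2⟩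

/-- Conditional satisfaction only involves the interpretations between `I` and `M`. -/
theorem condSat_iff (hl : l.Over P.preds P.consts) (hIM : I ⊆ M) (hM : M ⊆ P.base) :
    P.CondSat ι I M l ↔ ∀ J, I ⊆ J → J ⊆ M → P.Sat ι J l := by
  constructor
  · rintro ⟨-, -, -, h⟩ J hIJ hJM
    refine h J (hJM.trans hM) (fun a ha => hIJ ha.1.1) ?_
    exact Set.eq_empty_of_forall_notMem fun a ha => ha.1.2 (hJM ha.2)
  · intro h
    refine ⟨Set.inter_subset_right, Set.sdiff_subset,
      Set.disjoint_left.mpr fun a ha ha' => ha'.2 ha.1.2, fun J hJ hIJ hMJ => ?_⟩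
    refine (sat_congr hl fun a ha => ?_).mp
      -- This set agrees with `J` on `P.aggBase l`, because `J` contains `I ∩ M` there, and it lies
      -- below `M`, because `J` avoids `P.aggBase l \ M`.
      (h ((J ∩ P.aggBase l) ∪ I) Set.subset_union_right ?_)
    · refine ⟨fun h => h.elim (fun h => h.1) fun h => hIJ ⟨⟨h, hIM h⟩, ha⟩, fun h => .inl ⟨h, ha⟩⟩
    · refine Set.union_subset (fun a ha => ?_) hIM
      by_contra haM
      exact (Set.eq_empty_iff_forall_notMem.mp hMJ) a ⟨⟨ha.2, haM⟩, ha.1⟩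

/-- The body of the rule `r` holds with respect to `I` and `M`. -/
def Fires (P : Program) (ι : AggInterp) (M I : Set Atom) (r : Rule) : Prop :=
  (∀ b ∈ r.neg, b ∉ M) ∧ (∀ b ∈ r.pos, b ∈ I) ∧ ∀ l ∈ r.agg, P.CondSat ι I M l

theorem mem_K_iff {a : Atom} : a ∈ P.K ι M I ↔ ∃ r ∈ P.rules, r.head = a ∧ P.Fires ι M I r := by
  constructor
  · rintro ⟨_, ⟨r, hr, hn, rfl⟩, rfl, hp, ha⟩
    exact ⟨r, hr, rfl, hn, hp, ha⟩
  · rintro ⟨r, hr, rfl, hn, hp, ha⟩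
    exact ⟨_, ⟨r, hr, hn, rfl⟩, rfl, hp, ha⟩

theorem Fires.mono (h : I ⊆ J) (hr : P.Fires ι M I r) : P.Fires ι M J r :=
  ⟨hr.1, fun b hb => h (hr.2.1 b hb), fun l hl => (hr.2.2 l hl).mono h⟩

/-- The heads of the rules in a list. -/
def heads (rs : List Rule) : Set Atom := {a | ∃ r ∈ rs, r.head = a}

theorem heads_cons : heads (r :: rs) = insert r.head (heads rs) := by
  ext a
  simp [heads, eq_comm]

/-- A list of rules in which every rule fires with respect to `M` and the heads of the rules
behind it. -/
def Derivation (P : Program) (ι : AggInterp) (M : Set Atom) : List Rule → Prop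
  | [] => True
  | r :: rs => r ∈ P.rules ∧ P.Fires ι M (heads rs) r ∧ Derivation P ι M rs

theorem Derivation.mem_rules (h : P.Derivation ι M rs) : ∀ r ∈ rs, r ∈ P.rules := by
  induction rs with
  | nil => simp
  | cons r rs ih => simpa using ⟨h.1, ih h.2.2⟩

theorem Derivation.fires (h : P.Derivation ι M rs) : ∀ r ∈ rs, P.Fires ι M (heads rs) r := by
  induction rs with
  | nil => simp
  | cons r rs ih =>
    have hs : heads rs ⊆ heads (r :: rs) := heads_cons ▸ Set.subset_insert _ _
    simpa using ⟨h.2.1.mono hs, fun a ha => (ih h.2.2 a ha).mono hs⟩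

/-- By monotonicity each rule still fires with respect to `I`, which is closed under the operator.
-/
theorem Derivation.heads_subset (h : P.Derivation ι M rs) (hI : P.K ι M I ⊆ I) :
    heads rs ⊆ I := by
  induction rs with
  | nil => simp [heads]
  | cons r rs ih =>
    rw [heads_cons]
    exact Set.insert_subset (hI (mem_K_iff.mpr ⟨r, h.1, rfl, h.2.1.mono (ih h.2.2)⟩)) (ih h.2.2)

theorem Derivation.heads_subset_K (h : P.Derivation ι M rs) : heads rs ⊆ P.K ι M (heads rs) := by
  rintro _ ⟨r, hr, rfl⟩
  exact mem_K_iff.mpr ⟨r, h.mem_rules r hr, rfl, h.fires r hr⟩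

theorem heads_subset_base (h : ∀ r ∈ rs, r ∈ P.rules) : heads rs ⊆ P.base := by
  rintro _ ⟨r, hr, rfl⟩
  exact (P.rules_over r (h r hr)).1

theorem Derivation.isFixpointAnswerSet (h : P.Derivation ι (heads rs) rs)
    (hc : ∀ r ∈ P.rules, P.Fires ι (heads rs) (heads rs) r → r.head ∈ heads rs) :
    P.IsFixpointAnswerSet ι (heads rs) := by
  refine ⟨⟨heads_subset_base h.mem_rules, Set.Subset.antisymm ?_ h.heads_subset_K⟩,
    fun I hI => h.heads_subset hI.2.le⟩
  intro a ha
  obtain ⟨r, hr, rfl, hf⟩ := mem_K_iff.mp ha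
  exact hc r hr hf

/-- Take a longest derivation without repeated rules. A rule that fires but whose head is missing
could be put in front of it, so its heads form a fixpoint, which is `M` by leastness. Absence of
repetitions bounds the length by that of the program. -/
theorem exists_derivation (h : P.IsFixpointAnswerSet ι M) :
    ∃ rs, rs.length ≤ P.rules.length ∧ P.Derivation ι M rs ∧ heads rs = M := by
  let S : Set ℕ := {n | ∃ rs : List Rule, rs.Nodup ∧ P.Derivation ι M rs ∧ rs.length = n}
  have hS : ∀ n ∈ S, n ≤ P.rules.length := by
    rintro _ ⟨rs, hn, hd, rfl⟩
    exact (hn.subperm hd.mem_rules).length_le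
  have hmax : ∃ n ∈ S, ∀ k ∈ S, k ≤ n :=
    ⟨sSup S, Nat.sSup_mem ⟨0, [], List.nodup_nil, trivial, rfl⟩ ⟨_, hS⟩,
      fun k hk => le_csSup ⟨_, hS⟩ hk⟩
  obtain ⟨_, ⟨rs, hn, hd, rfl⟩, hm⟩ := hmax
  refine ⟨rs, hS _ ⟨rs, hn, hd, rfl⟩, hd, (hd.heads_subset h.1.2.le).antisymm ?_⟩
  refine h.2 ⟨heads_subset_base hd.mem_rules, Set.Subset.antisymm ?_ hd.heads_subset_K⟩
  intro a ha
  obtain ⟨r, hr, rfl, hf⟩ := mem_K_iff.mp ha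
  by_contra hnot
  have := hm _ ⟨r :: rs, List.nodup_cons.mpr ⟨fun hmem => hnot ⟨r, hmem, rfl⟩, hn⟩,
    ⟨hr, hf, hd⟩, rfl⟩
  simp at this

end Program

/-! ### Codes -/

namespace Sexp

theorem toList_ofList {α : Type} (f : α → Sexp) (l : List α) : (ofList f l).toList = l.map f := by
  induction l with
  | nil => rfl
  | cons a l ih => simpa [ofList, toList] using ih

theorem ofList_injective {α : Type} {f : α → Sexp} (hf : f.Injective) : (ofList f).Injective :=
  fun l l' h => List.map_injective_iff.mpr hf <| by
    rw [← toList_ofList, ← toList_ofList, h]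

/-- Every tree is a `nil`-terminated list along its right spine, so only its members need decoding.
-/
theorem exists_eq_ofList {α : Type} {f : α → Sexp} {p : α → Prop} {x : Sexp}
    (h : ∀ y ∈ x.toList, ∃ a, f a = y ∧ p a) : ∃ l : List α, ofList f l = x ∧ ∀ a ∈ l, p a := by
  induction x with
  | nil => exact ⟨[], rfl, by simp⟩
  | cons a b _ ih =>
    simp only [toList, List.mem_cons, forall_eq_or_imp] at h
    obtain ⟨⟨a, rfl, ha⟩, hb⟩ := h
    obtain ⟨l, rfl, hl⟩ := ih hb
    exact ⟨a :: l, rfl, by simpa using ⟨ha, hl⟩⟩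

theorem ofBool_injective : ofBool.Injective := by
  intro a b
  cases a <;> cases b <;> simp [ofBool]

theorem foldr_bit_bits (n : ℕ) : n.bits.foldr Nat.bit 0 = n := by
  induction n using Nat.binaryRec' with
  | zero => simp
  | bit b n hb ih => rw [Nat.bits_append_bit n b hb, List.foldr_cons, ih]

theorem ofNat_injective : ofNat.Injective := fun m n h => by
  rw [← foldr_bit_bits m, ← foldr_bit_bits n, ofList_injective ofBool_injective h]

theorem ofInt_injective : ofInt.Injective := fun m n h => by
  simp only [ofInt, cons.injEq] at h
  have h₁ := ofBool_injective h.1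
  have h₂ := ofNat_injective h.2
  rw [decide_eq_decide] at h₁
  omega

theorem ofConst_injective : ofConst.Injective := by
  intro a b h
  cases a <;> cases b <;> simp [ofConst, ofBool] at h ⊢
  · exact ofInt_injective h
  · exact ofNat_injective h

/-- The verifier compares atoms as trees; injectivity makes this faithful. -/
theorem ofAtom_injective : ofAtom.Injective := by
  rintro ⟨p, as⟩ ⟨q, bs⟩ h
  simp only [ofAtom, cons.injEq] at h
  rw [ofNat_injective h.1, ofList_injective ofConst_injective h.2]

theorem size_le_size_ofList {α : Type} (f : α → Sexp) {l : List α} {a : α} (ha : a ∈ l) :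
    (f a).size ≤ (ofList f l).size := by
  induction l with
  | nil => simp at ha
  | cons b l ih =>
    change (f a).size ≤ 1 + (f b).size + (ofList f l).size
    rcases List.mem_cons.mp ha with rfl | ha
    · omega
    · have := ih ha
      omega

theorem length_le_size_ofList {α : Type} (f : α → Sexp) (l : List α) :
    l.length ≤ (ofList f l).size := by
  induction l with
  | nil => simp
  | cons b l ih =>
    change l.length + 1 ≤ 1 + (f b).size + (ofList f l).size
    omega

theorem size_ofList_le {α : Type} (f : α → Sexp) (l : List α) {B : ℕ}
    (hB : ∀ a ∈ l, (f a).size ≤ B) : (ofList f l).size ≤ 1 + l.length * (1 + B) := by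
  induction l with
  | nil => simp [ofList, size]
  | cons b l ih =>
    change 1 + (f b).size + (ofList f l).size ≤ 1 + (l.length + 1) * (1 + B)
    have h₁ := hB b (by simp)
    have h₂ := ih fun a ha => hB a (by simp [ha])
    rw [add_one_mul]
    omega

/-- Every subset of the heads of a certificate has a listing no larger than the certificate, so
short `u` reach all relevant interpretations. -/
theorem size_ofList_heads_filter_le (rs : List Rule) (p : Atom → Bool) :
    (ofList ofAtom ((rs.map Rule.head).filter p)).size ≤ (ofList ofRule rs).size := by
  induction rs with
  | nil => simp [ofList]
  | cons r rs ih =>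
    have hr : (ofAtom r.head).size ≤ (ofRule r).size := (ofRule r).size_hd_le
    rw [List.map_cons, List.filter_cons]
    split_ifs
    · change 1 + (ofAtom r.head).size + (ofList ofAtom _).size ≤ 1 + (ofRule r).size + _
      exact add_le_add (by omega) ih
    · change _ ≤ 1 + (ofRule r).size + _
      exact ih.trans (by simp [ofList])

end Sexp

/-! ### The predicate checked by the verifier -/

namespace Certificate

open Sexp

/-- `a` is the head of one of the coded rules in the list `w`. -/
def IsHead (a w : Sexp) : Prop := ∃ r ∈ w.toList, r.hd = a

/-- The list `u` consists of heads of rules in `w`. -/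
def Within (u w : Sexp) : Prop := ∀ a ∈ u.toList, IsHead a w

/-- All heads of rules in `w` are in the list `u`. -/
def Covers (w u : Sexp) : Prop := ∀ r ∈ w.toList, ∃ a ∈ u.toList, a = r.hd

/-- The first rule of the final segment `t` of `w` belongs to the program `x` and fires, as far
as the interpretation `u` can tell. -/
def StepOk (A : Lang) (x w u t : Sexp) : Prop :=
  (∃ r ∈ x.tl.tl.toList, r = t.hd) ∧ (∀ b ∈ t.hd.tl.tl.tl.toList, ¬ IsHead b w) ∧
    (∀ b ∈ t.hd.tl.tl.hd.toList, IsHead b t.tl) ∧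
    (Within u w → Covers t.tl u → ∀ l ∈ t.hd.tl.hd.toList, cons l u ∈ A)

/-- If the rule `r` fires with respect to the heads of `w`, then its head is one of them. -/
def ClosedUnder (A : Lang) (w u r : Sexp) : Prop :=
  IsHead r.hd w ∨ (∃ b ∈ r.tl.tl.tl.toList, IsHead b w) ∨ (∃ b ∈ r.tl.tl.hd.toList, ¬ IsHead b w) ∨
    ∃ l ∈ r.tl.hd.toList, cons l u ∉ A

/-- The list `w` of rules passes the test of being a derivation of an answer set of the program
`x` posed by the list `u` of atoms. -/
def Passes (A : Lang) (x w u : Sexp) : Prop :=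
  w.AllTail (StepOk A x w u) ∧
    (Within u w → Covers w u → ∀ r ∈ x.tl.tl.toList, ClosedUnder A w u r)

/-! ### Polynomial-time decidability of the verifier's test. -/

section PolyDec

variable {O : Lang} {f g h k : Sexp → Sexp}

/-- Under a bounded quantifier the argument becomes the pair of the bound element and the old
argument, so `.hd .id` is the bound variable and `comp (.tl .id)` shifts an outer function past the
binder. -/
theorem polyDec_isHead (hf : PolyTime O f) (hg : PolyTime O g) :
    PolyDec O (fun z => IsHead (f z) (g z)) :=
  .exists_mem (p := fun r z => r.hd = f z) hg (.eq (.hd (.hd .id)) (hf.comp (.tl .id)))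

theorem polyDec_within (hf : PolyTime O f) (hg : PolyTime O g) :
    PolyDec O (fun z => Within (f z) (g z)) :=
  .forall_mem (p := fun a z => IsHead a (g z)) hf
    (polyDec_isHead (.hd .id) (hg.comp (.tl .id)))

theorem polyDec_covers (hf : PolyTime O f) (hg : PolyTime O g) :
    PolyDec O (fun z => Covers (f z) (g z)) :=
  .forall_mem (p := fun r z => ∃ a ∈ (g z).toList, a = r.hd) hf <|
    .exists_mem (p := fun a z => a = z.hd.hd) (hg.comp (.tl .id))
      (.eq (.hd .id) (.hd (.hd (.tl .id))))

theorem polyDec_stepOk (hx : PolyTime O f) (hw : PolyTime O g) (hu : PolyTime O h)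
    (ht : PolyTime O k) : PolyDec O (fun z => StepOk O (f z) (g z) (h z) (k z)) := by
  refine .and ?_ (.and ?_ (.and ?_ (.imp (polyDec_within hu hw)
    (.imp (polyDec_covers (.tl ht) hu) ?_))))
  · exact .exists_mem (p := fun r z => r = (k z).hd) (.tl (.tl hx))
      (.eq (.hd .id) (.hd (ht.comp (.tl .id))))
  · exact .forall_mem (p := fun b z => ¬ IsHead b (g z)) (.tl (.tl (.tl (.hd ht))))
      (.not (polyDec_isHead (.hd .id) (hw.comp (.tl .id))))
  · exact .forall_mem (p := fun b z => IsHead b (k z).tl) (.hd (.tl (.tl (.hd ht))))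
      (polyDec_isHead (.hd .id) (.tl (ht.comp (.tl .id))))
  · exact .forall_mem (p := fun l z => cons l (h z) ∈ O) (.hd (.tl (.hd ht)))
      (.query (.cons (.hd .id) (hu.comp (.tl .id))))

theorem polyDec_closedUnder (hw : PolyTime O f) (hu : PolyTime O g) (hr : PolyTime O h) :
    PolyDec O (fun z => ClosedUnder O (f z) (g z) (h z)) := by
  refine .or (polyDec_isHead (.hd hr) hw) (.or ?_ (.or ?_ ?_))
  · exact .exists_mem (p := fun b z => IsHead b (f z)) (.tl (.tl (.tl hr)))
      (polyDec_isHead (.hd .id) (hw.comp (.tl .id)))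
  · exact .exists_mem (p := fun b z => ¬ IsHead b (f z)) (.hd (.tl (.tl hr)))
      (.not (polyDec_isHead (.hd .id) (hw.comp (.tl .id))))
  · exact .exists_mem (p := fun l z => cons l (g z) ∉ O) (.hd (.tl hr))
      (.not (.query (.cons (.hd .id) (hu.comp (.tl .id)))))

theorem polyDec_passes (O : Lang) : PolyDec O (fun z => Passes O z.hd.hd z.hd.tl z.tl) := by
  have hx : PolyTime O (fun z => z.hd.hd) := .hd (.hd .id)
  have hw : PolyTime O (fun z => z.hd.tl) := .tl (.hd .id)
  have hu : PolyTime O (fun z => z.tl) := .tl .id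
  refine .and ?_ (.imp (polyDec_within hu hw) (.imp (polyDec_covers hw hu) ?_))
  · exact .allTail (p := fun t z => StepOk O z.hd.hd z.hd.tl z.tl t) hw
      (polyDec_stepOk (hx.comp hu) (hw.comp hu) (hu.comp hu) (.hd .id))
  · exact .forall_mem (p := fun r z => ClosedUnder O z.hd.tl z.tl r) (.tl (.tl hx))
      (polyDec_closedUnder (hw.comp hu) (hu.comp hu) (.hd .id))

end PolyDec

/-! ### Correctness of the verifier's test on coded programs. -/

section Codes

variable {P : Program} {ι : AggInterp} {A : Lang} {r : Rule} {rs ts : List Rule}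

open Program

theorem isHead_ofList {a : Atom} : IsHead (ofAtom a) (ofList ofRule rs) ↔ a ∈ heads rs := by
  simp [IsHead, toList_ofList, heads, ofRule, ofAtom_injective.eq_iff]

theorem covers_ofList {us : List Atom} :
    Covers (ofList ofRule rs) (ofList ofAtom us) ↔ heads rs ⊆ {a | a ∈ us} := by
  simp [Covers, toList_ofList, heads, ofRule, ofAtom_injective.eq_iff, Set.subset_def]

theorem within_ofList {u : Sexp} : Within u (ofList ofRule rs) ↔
    ∃ us : List Atom, ofList ofAtom us = u ∧ {a | a ∈ us} ⊆ heads rs := by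
  constructor
  · refine fun h => exists_eq_ofList fun y hy => ?_
    obtain ⟨z, hz, rfl⟩ := h y hy
    rw [toList_ofList, List.mem_map] at hz
    obtain ⟨r, hr, rfl⟩ := hz
    exact ⟨r.head, rfl, r, hr, rfl⟩
  · rintro ⟨us, rfl, h⟩ y hy
    rw [toList_ofList, List.mem_map] at hy
    obtain ⟨a, ha, rfl⟩ := hy
    exact isHead_ofList.mpr (h ha)

open Classical in
theorem exists_listing {J : Set Atom} (hJ : J ⊆ heads rs) : ∃ us : List Atom,
    {a | a ∈ us} = J ∧ (ofList ofAtom us).size ≤ (ofList ofRule rs).size := by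
  refine ⟨(rs.map Rule.head).filter (· ∈ J), ?_, size_ofList_heads_filter_le _ _⟩
  ext a
  simpa [heads] using fun ha => hJ ha

/-- If `u` is not a listing of some `J` with `heads ts ⊆ J ⊆ heads rs`, the aggregate condition is
vacuous; the remaining `u` reach exactly the interpretations in `condSat_iff`. -/
theorem forall_stepOk_iff (hA : ∀ l, P.HasAgg l → P.AggDecidedBy ι A l)
    (hrs : ∀ r ∈ rs, r ∈ P.rules) (hr : r ∈ P.rules) (hts : heads ts ⊆ heads rs) {N : ℕ}
    (hN : (ofList ofRule rs).size ≤ N) :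
    (∀ u : Sexp, u.size ≤ N →
      StepOk A (ofProgram P) (ofList ofRule rs) u (cons (ofRule r) (ofList ofRule ts))) ↔
      P.Fires ι (heads rs) (heads ts) r := by
  have hbase := heads_subset_base hrs
  have hquery : ∀ l ∈ r.agg, ∀ us : List Atom, {a | a ∈ us} ⊆ heads rs →
      (cons (ofAggAtom l) (ofList ofAtom us) ∈ A ↔ P.Sat ι {a | a ∈ us} l) :=
    fun l hl us hus => hA l ⟨r, hr, hl⟩ us (hus.trans hbase)
  have hcond : ∀ l ∈ r.agg, (P.CondSat ι (heads ts) (heads rs) l ↔ _) := fun l hl =>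
    condSat_iff ((P.rules_over r hr).2.1 l hl) hts hbase
  have hmem : ∃ y ∈ (ofProgram P).tl.tl.toList, y = ofRule r := by
    simpa [ofProgram, toList_ofList] using ⟨r, hr, rfl⟩
  have key : ∀ u, StepOk A (ofProgram P) (ofList ofRule rs) u
      (cons (ofRule r) (ofList ofRule ts)) ↔ (∀ b ∈ r.neg, b ∉ heads rs) ∧
      (∀ b ∈ r.pos, b ∈ heads ts) ∧ (Within u (ofList ofRule rs) → Covers (ofList ofRule ts) u →
        ∀ l ∈ r.agg, cons (ofAggAtom l) u ∈ A) := by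
    intro u
    simp only [StepOk, hd_cons, tl_cons, hmem, true_and]
    simp [ofRule, toList_ofList, isHead_ofList]
  simp only [key]
  constructor
  · intro h
    -- The conditions on `neg` and `pos` do not depend on `u`, so any `u` within the bound yields
    -- them.
    have h₀ := h _ ((size_ofList_heads_filter_le rs fun _ => true).trans hN)
    refine ⟨h₀.1, h₀.2.1, fun l hl => (hcond l hl).mpr fun J hJ hJ' => ?_⟩
    obtain ⟨us, rfl, hus⟩ := exists_listing hJ'
    exact (hquery l hl us hJ').mp <|
      (h _ (hus.trans hN)).2.2 (within_ofList.mpr ⟨us, rfl, hJ'⟩) (covers_ofList.mpr hJ) l hl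
  · refine fun h u _ => ⟨h.1, h.2.1, fun hw hc l hl => ?_⟩
    obtain ⟨us, rfl, hus⟩ := within_ofList.mp hw
    exact (hquery l hl us hus).mpr
      ((hcond l hl).mp (h.2.2 l hl) _ (covers_ofList.mp hc) hus)

/-- With `I = M` the interval of interpretations collapses to `M`, so one query on a listing of `M`
settles conditional satisfaction either way. -/
theorem closedUnder_iff (hA : ∀ l, P.HasAgg l → P.AggDecidedBy ι A l)
    (hrs : ∀ r ∈ rs, r ∈ P.rules) (hr : r ∈ P.rules) {us : List Atom}
    (hus : {a | a ∈ us} = heads rs) :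
    ClosedUnder A (ofList ofRule rs) (ofList ofAtom us) (ofRule r) ↔
      (P.Fires ι (heads rs) (heads rs) r → r.head ∈ heads rs) := by
  have hbase := heads_subset_base hrs
  have hcond : ∀ l ∈ r.agg, (P.CondSat ι (heads rs) (heads rs) l ↔
      cons (ofAggAtom l) (ofList ofAtom us) ∈ A) := by
    intro l hl
    rw [condSat_iff ((P.rules_over r hr).2.1 l hl) subset_rfl hbase]
    refine Iff.trans ?_ (hA l ⟨r, hr, hl⟩ us (hus ▸ hbase)).symm
    rw [hus]
    exact ⟨fun h => h _ subset_rfl subset_rfl, fun h J h₁ h₂ => h₂.antisymm h₁ ▸ h⟩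
  have key : ClosedUnder A (ofList ofRule rs) (ofList ofAtom us) (ofRule r) ↔
      r.head ∈ heads rs ∨ (∃ b ∈ r.neg, b ∈ heads rs) ∨ (∃ b ∈ r.pos, b ∉ heads rs) ∨
        ∃ l ∈ r.agg, ¬ P.CondSat ι (heads rs) (heads rs) l := by
    simp only [ClosedUnder, ofRule, hd_cons, tl_cons, toList_ofList, isHead_ofList,
      List.mem_map, exists_exists_and_eq_and]
    refine or_congr_right (or_congr_right (or_congr_right
      (exists_congr fun l => and_congr_right fun hl => ?_)))
    rw [hcond l hl]
  rw [key, Fires]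
  constructor
  · rintro (h | ⟨b, hb, hb'⟩ | ⟨b, hb, hb'⟩ | ⟨l, hl, hl'⟩) hf
    · exact h
    · exact absurd hb' (hf.1 b hb)
    · exact absurd (hf.2.1 b hb) hb'
    · exact absurd (hf.2.2 l hl) hl'
  · intro h
    by_contra! hn
    exact hn.1 (h hn.2)

theorem forall_passes_iff (hA : ∀ l, P.HasAgg l → P.AggDecidedBy ι A l)
    (hrs : ∀ r ∈ rs, r ∈ P.rules) {N : ℕ} (hN : (ofList ofRule rs).size ≤ N) :
    (∀ u : Sexp, u.size ≤ N → Passes A (ofProgram P) (ofList ofRule rs) u) ↔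
      P.Derivation ι (heads rs) rs ∧
        ∀ r ∈ P.rules, P.Fires ι (heads rs) (heads rs) r → r.head ∈ heads rs := by
  -- The induction runs over final segments `ts`, while `M` stays `heads rs` for the whole list.
  have hsteps : ∀ ts : List Rule, (∀ r ∈ ts, r ∈ rs) →
      ((∀ u : Sexp, u.size ≤ N →
        (ofList ofRule ts).AllTail (StepOk A (ofProgram P) (ofList ofRule rs) u)) ↔
        P.Derivation ι (heads rs) ts) := by
    intro ts
    induction ts with
    | nil => simp [ofList, AllTail, Program.Derivation]
    | cons r ts ih =>
      intro hts
      simp only [List.mem_cons, forall_eq_or_imp] at hts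
      have hsub : heads ts ⊆ heads rs := by
        rintro _ ⟨t, ht, rfl⟩
        exact ⟨t, hts.2 t ht, rfl⟩
      rw [Program.Derivation, ← ih hts.2, ← forall_stepOk_iff hA hrs (hrs r hts.1) hsub hN]
      refine ⟨fun h => ⟨hrs r hts.1, fun u hu => (h u hu).1, fun u hu => (h u hu).2⟩,
        fun h u hu => ⟨h.2.1 u hu, h.2.2 u hu⟩⟩
  have hrules : (ofProgram P).tl.tl.toList = P.rules.map ofRule := toList_ofList _ _
  rw [← hsteps rs fun _ h => h]
  refine ⟨fun h => ⟨fun u hu => (h u hu).1, fun r hr => ?_⟩, fun h u hu => ⟨h.1 u hu, ?_⟩⟩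
  · obtain ⟨us, hus, hsize⟩ := exists_listing (rs := rs) (subset_refl _)
    refine (closedUnder_iff hA hrs hr hus).mp ?_
    refine (h _ (hsize.trans hN)).2 (within_ofList.mpr ⟨us, rfl, hus.le⟩)
      (covers_ofList.mpr hus.ge) _ ?_
    rw [hrules]
    exact List.mem_map_of_mem hr
  · intro hw hc y hy
    obtain ⟨us, rfl, hus⟩ := within_ofList.mp hw
    rw [hrules, List.mem_map] at hy
    obtain ⟨r, hr, rfl⟩ := hy
    exact (closedUnder_iff hA hrs hr (hus.antisymm (covers_ofList.mp hc))).mpr (h.2 r hr)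

theorem exists_rules_of_allTail {w u t : Sexp}
    (h : t.AllTail (StepOk A (ofProgram P) w u)) :
    ∃ rs : List Rule, ofList ofRule rs = t ∧ ∀ r ∈ rs, r ∈ P.rules := by
  refine exists_eq_ofList ?_
  induction t with
  | nil => simp [toList]
  | cons a b _ ih =>
    simp only [toList, List.mem_cons, forall_eq_or_imp]
    refine ⟨?_, ih h.2⟩
    obtain ⟨y, hy, rfl⟩ := h.1.1
    rw [show (ofProgram P).tl.tl.toList = _ from toList_ofList _ _, List.mem_map] at hy
    obtain ⟨r, hr, hr'⟩ := hy
    exact ⟨r, hr', hr⟩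

theorem exists_certificate_iff (hA : ∀ l, P.HasAgg l → P.AggDecidedBy ι A l) :
    (∃ w : Sexp, w.size ≤ 1 + (ofProgram P).size * (1 + (ofProgram P).size) ∧
      ∀ u : Sexp, u.size ≤ (cons (ofProgram P) w).size → Passes A (ofProgram P) w u) ↔
      ∃ M : Set Atom, P.IsFixpointAnswerSet ι M := by
  have hN : ∀ w, w.size ≤ (cons (ofProgram P) w).size := fun w => by
    simp only [size]; omega
  constructor
  · rintro ⟨w, -, h⟩
    -- Any admissible `u` shows that the entries of an arbitrary `w` are rules of the program; here
    -- `u` is `w` itself.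
    obtain ⟨rs, rfl, hrs⟩ := exists_rules_of_allTail (h _ (hN _)).1
    obtain ⟨hd, hc⟩ := (forall_passes_iff hA hrs (hN _)).mp h
    exact ⟨_, hd.isFixpointAnswerSet hc⟩
  · rintro ⟨M, hM⟩
    obtain ⟨rs, hlen, hd, rfl⟩ := exists_derivation hM
    refine ⟨ofList ofRule rs, ?_, (forall_passes_iff hA hd.mem_rules (hN _)).mpr
      ⟨hd, fun r hr hf => hM.1.2.le (mem_K_iff.mpr ⟨r, hr, rfl, hf⟩)⟩⟩
    have hle : (ofList ofRule P.rules).size ≤ (ofProgram P).size :=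
      (ofProgram P).tl.size_tl_le.trans (ofProgram P).size_tl_le
    -- The derivation has at most as many entries as the program has rules, each with a code no
    -- larger than that of the program.
    refine (size_ofList_le ofRule rs fun r hr =>
      (size_le_size_ofList ofRule (hd.mem_rules r hr)).trans hle).trans ?_
    exact Nat.add_le_add_left (Nat.mul_le_mul_right _
      (hlen.trans ((length_le_size_ofList ofRule _).trans hle))) _

end Codes

end Certificate

/-- The answer set existence problem for `𝒞`-decidable programs is in `NP^(co-NP^𝒞)`. -/
theorem mainTheorem9 (ι : AggInterp) (𝒞 : Set Lang) (𝒬 : Set Program)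
    (h𝒬 : ClassDecidable ι 𝒞 𝒬) :
    ProblemIn (NPRel (coNPRel 𝒞)) 𝒬 (fun P => ∃ M : Set Atom, P.IsFixpointAnswerSet ι M) := by
  obtain ⟨A, hA, hdec⟩ := h𝒬
  refine ⟨_, mem_NPRel_coNPRel hA (Certificate.polyDec_passes A) (1 + .X * (1 + .X)) .X,
    fun P hP => ?_⟩
  refine Iff.trans ?_ (Certificate.exists_certificate_iff (hdec P hP))
  simp
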